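/- Let $k$ be a field of characteristic zero, $n\ge 1$, $R=k[x_1,\dots,x_n]$ and $S=k[X_1,\dots,X_n]$, where $R$ acts on $S$ by differentiation, $x_i\circ g=\partial g/\partial X_i$; for $g\in S$ put $\operatorname{ann}(g)=\{f\in R: f\circ g=0\}$. Equip $R$ with the degree reverse lexicographic order with $x_1\succ\cdots\succ x_n$, and let $\operatorname{in}(I)$ denote the ideal generated by the leading terms of the elements of an ideal $I$. Let $H_e\in S$ be the sum of all monomials of degree $e$ (the complete symmetric polynomial). Let $\varphi:R\to R$ be the $k$-linear map with $\varphi(x_1^{i_1}\cdots x_n^{i_n})=\frac{1}{i_1!\cdots i_n!}x_1^{i_1}\cdots x_n^{i_n}$, and for $\underline a=(a_1,\dots,a_{n-1})\in\mathbb N^{n-1}$ (where $0\in\mathbb N$) put $|\underline a|=a_1+\cdots+a_{n-1}$ and $F_{\underline a}=(x_1-x_n)^{a_1}\cdots(x_{n-1}-x_n)^{a_{n-1}}$. A Gröbner basis of an ideal $I$ is a finite subset of $I$ whose leading terms generate $\operatorname{in}(I)$; it is called minimal if its elements are nonzero and the leading monomial of no element divides the leading monomial of another element. Let $e\ge 1$.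 1. If $G\in S$ is a generic form of degree $e$, then $\operatorname{in}(\operatorname{ann}(G))=\operatorname{in}(\operatorname{ann}(H_e))$. Here "generic" means: there is a nonzero polynomial $\Phi$ with integer coefficients, in variables indexed by the monomials of degree $e$, such that the equality holds for every form $G$ of degree $e$ whose coefficients do not form a zero of $\Phi$ (in particular, it holds for all $G$ in a nonempty Zariski-open set of forms of degree $e$). 2. If $e=2d$ is even, then $$\mathcal G_{2d}=\{\varphi(F_{\underline a}):|\underline a|=d+1\}\cup\{\varphi(x_n^{2i+1}F_{\underline a}): i=0,\dots,d \text{ and } |\underline a|=d-i\}$$ is a minimal Gröbner basis of $\operatorname{ann}(H_{2d})$. 3. If $e=2d+1$ is odd, then $$\mathcal G_{2d+1}=\{\varphi(x_n^{2i}F_{\underline a}): i=0,\dots,d+1 \text{ and } |\underline a|=d+1-i\}$$ is a minimal Gröbner basis of $\operatorname{ann}(H_{2d+1})$. -/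

import Mathlib

open MvPolynomial

/-! ### The degree reverse lexicographic order -/

/-- Exponent vectors, to be equipped with the degree reverse lexicographic order. -/
def DegRevLex (σ : Type*) : Type _ := σ →₀ ℕ

namespace DegRevLex

variable {σ : Type*}

noncomputable instance : AddCommMonoid (DegRevLex σ) :=
  inferInstanceAs (AddCommMonoid (σ →₀ ℕ))

/-- The identity, as an additive equivalence. -/
noncomputable def of (σ : Type*) : (σ →₀ ℕ) ≃+ DegRevLex σ := AddEquiv.refl (σ →₀ ℕ)

/-- The comparison key: first the degree, then the reverse of the colexicographic order (where the
colexicographic order compares first the exponents of the largest index). -/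
noncomputable def key (a : DegRevLex σ) : ℕ ×ₗ (Colex (σ →₀ ℕ))ᵒᵈ :=
  toLex (((of σ).symm a).degree, OrderDual.toDual (toColex ((of σ).symm a)))

theorem key_injective : Function.Injective (key (σ := σ)) := by
  intro a b h
  have h2 : ((ofLex (key a)).2) = ((ofLex (key b)).2) := by rw [h]
  exact h2

variable [LinearOrder σ]

noncomputable instance : LinearOrder (DegRevLex σ) := LinearOrder.lift' key key_injective

theorem lt_iff_colex (a b : σ →₀ ℕ) : of σ a < of σ b ↔
    a.degree < b.degree ∨ (a.degree = b.degree ∧ toColex b < toColex a) := by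
  change toLex (a.degree, OrderDual.toDual (toColex a))
    < toLex (b.degree, OrderDual.toDual (toColex b)) ↔ _
  rw [Prod.Lex.toLex_lt_toLex]
  exact Iff.rfl

/-- The usual description: `x^a ≺ x^b` iff `deg a < deg b`, or the degrees agree and at the last
index `i` where `a` and `b` differ one has `b i < a i`. -/
theorem lt_iff (a b : σ →₀ ℕ) : of σ a < of σ b ↔
    a.degree < b.degree ∨
      (a.degree = b.degree ∧ ∃ i, (∀ j, i < j → a j = b j) ∧ b i < a i) := by
  rw [lt_iff_colex, Finsupp.Colex.lt_iff]
  simp only [eq_comm, ofColex_toColex]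

theorem le_iff_colex (a b : σ →₀ ℕ) : of σ a ≤ of σ b ↔
    a.degree < b.degree ∨ (a.degree = b.degree ∧ toColex b ≤ toColex a) := by
  change toLex (a.degree, OrderDual.toDual (toColex a))
    ≤ toLex (b.degree, OrderDual.toDual (toColex b)) ↔ _
  rw [Prod.Lex.toLex_le_toLex]
  exact Iff.rfl

instance : IsOrderedAddMonoid (DegRevLex σ) where
  add_le_add_left a b h c := by
    obtain ⟨a, rfl⟩ := (of σ).surjective a
    obtain ⟨b, rfl⟩ := (of σ).surjective b
    obtain ⟨c, rfl⟩ := (of σ).surjective c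
    rw [← map_add, ← map_add]
    rw [le_iff_colex] at h ⊢
    simpa [map_add] using h

theorem of_monotone : Monotone (of σ) := by
  intro a b h
  rw [le_iff_colex]
  rcases (Finsupp.degree_mono h).lt_or_eq with h' | h'
  · exact Or.inl h'
  · have hab : a = b := by
      obtain ⟨c, rfl⟩ := exists_add_of_le h
      have : c = 0 := by
        rw [← Finsupp.degree_eq_zero_iff]
        rw [map_add] at h'
        omega
      simp [this]
    subst hab
    exact Or.inr ⟨rfl, le_rfl⟩

instance [Finite σ] : WellFoundedLT (DegRevLex σ) := by
  rw [← wellQuasiOrderedLE_iff_wellFoundedLT]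
  exact of_monotone.wellQuasiOrderedLE_of_wellQuasiOrderedLE_of_surjective (of σ).surjective

end DegRevLex

/-- The degree reverse lexicographic monomial order with `x_i ≻ x_j` for `i < j`. -/
noncomputable def degRevLex (σ : Type*) [LinearOrder σ] [Finite σ] : MonomialOrder σ where
  syn := DegRevLex σ
  toSyn := DegRevLex.of σ
  toSyn_monotone := DegRevLex.of_monotone

/-! ### Initial ideals and Gröbner bases -/

/-- The initial ideal: the ideal generated by the leading terms of all the elements of `I`. -/
noncomputable def initialIdeal {σ k : Type*} [Field k] (m : MonomialOrder σ)
    (I : Ideal (MvPolynomial σ k)) : Ideal (MvPolynomial σ k) :=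
  Ideal.span (m.leadingTerm '' (I : Set (MvPolynomial σ k)))

/-- A Gröbner basis of `I`: a finite subset of `I` whose leading terms generate the initial
ideal of `I`. -/
structure IsGroebnerBasis {σ k : Type*} [Field k] (m : MonomialOrder σ)
    (B : Set (MvPolynomial σ k)) (I : Ideal (MvPolynomial σ k)) : Prop where
  finite : B.Finite
  subset : B ⊆ I
  span_leadingTerm : Ideal.span (m.leadingTerm '' B) = initialIdeal m I

/-- A Gröbner basis is minimal if its elements are nonzero and no leading monomial of an element
divides the leading monomial of another element. (`m.degree f` is the exponent vector of the
leading monomial of `f`, and divisibility of monomials is the componentwise order.) -/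
structure IsMinimalGroebnerBasis {σ k : Type*} [Field k] (m : MonomialOrder σ)
    (B : Set (MvPolynomial σ k)) (I : Ideal (MvPolynomial σ k)) : Prop
    extends IsGroebnerBasis m B I where
  ne_zero : ∀ f ∈ B, f ≠ 0
  not_dvd : ∀ f ∈ B, ∀ g ∈ B, f ≠ g → ¬ m.degree f ≤ m.degree g

/-! ### The differentiation action and annihilators -/

section Action

variable {σ k : Type*} [Field k]

/-- Partial derivatives commute. -/
theorem pderiv_commute (i j : σ) :
    Commute (pderiv (R := k) i).toLinearMap (pderiv (R := k) j).toLinearMap := by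
  refine LinearMap.ext fun p => ?_
  rw [p.as_sum, map_sum, map_sum]
  refine Finset.sum_congr rfl fun s _ => ?_
  simp only [Module.End.mul_apply, Derivation.coeFn_coe, pderiv_monomial]
  by_cases hij : i = j
  · rw [hij]
  · congr 1
    · rw [tsub_right_comm]
    · simp [hij, Ne.symm hij]
      ring

variable [Fintype σ]

theorem pairwise_commute_powers (σ k : Type*) [Field k] :
    Pairwise fun i j : σ => ∀ x y : Multiplicative ℕ,
      Commute (powersHom (Module.End k (MvPolynomial σ k)) (pderiv (R := k) i).toLinearMap x)
        (powersHom (Module.End k (MvPolynomial σ k)) (pderiv (R := k) j).toLinearMap y) := by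
  intro i j _ x y
  simpa only [powersHom_apply] using (pderiv_commute i j).pow_pow _ _

/-- The monoid homomorphism sending the exponent vector `a` to the differential operator
`∏ i, (∂/∂X_i)^(a i)`. -/
noncomputable def monomialDiff (σ k : Type*) [Field k] [Fintype σ] :
    Multiplicative (σ →₀ ℕ) →* Module.End k (MvPolynomial σ k) where
  toFun a := MonoidHom.noncommPiCoprod _ (pairwise_commute_powers σ k)
    (fun i => Multiplicative.ofAdd (a.toAdd i))
  map_one' := map_one (MonoidHom.noncommPiCoprod _ (pairwise_commute_powers σ k))
  map_mul' a b := map_mul (MonoidHom.noncommPiCoprod _ (pairwise_commute_powers σ k))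
    (fun i => Multiplicative.ofAdd (a.toAdd i)) (fun i => Multiplicative.ofAdd (b.toAdd i))

/-- The action of polynomials as constant coefficient differential operators: the algebra
homomorphism sending `x_i` to `∂/∂X_i` (see `diffAction_X`). -/
noncomputable def diffAction (σ k : Type*) [Field k] [Fintype σ] :
    MvPolynomial σ k →ₐ[k] Module.End k (MvPolynomial σ k) :=
  AddMonoidAlgebra.lift k _ _ (monomialDiff σ k)

theorem diffAction_X (i : σ) (g : MvPolynomial σ k) :
    diffAction σ k (X i) g = pderiv i g := by
  classical
  have h1 : diffAction σ k (X i)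
      = monomialDiff σ k (Multiplicative.ofAdd (Finsupp.single i 1)) := by
    have := AddMonoidAlgebra.lift_single (monomialDiff σ k) (Finsupp.single i 1) (1 : k)
    rw [one_smul] at this
    exact this
  have h2 : (fun j => Multiplicative.ofAdd ((Finsupp.single i 1 : σ →₀ ℕ) j))
      = Pi.mulSingle i (Multiplicative.ofAdd 1) := by
    funext j
    by_cases h : j = i
    · subst h; simp
    · simp [h]
  have h3 : monomialDiff σ k (Multiplicative.ofAdd (Finsupp.single i 1))
      = (pderiv (R := k) i).toLinearMap := by
    change MonoidHom.noncommPiCoprod _ (pairwise_commute_powers σ k)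
      (fun j => Multiplicative.ofAdd ((Finsupp.single i 1 : σ →₀ ℕ) j)) = _
    rw [h2, MonoidHom.noncommPiCoprod_mulSingle]
    simp [powersHom_apply]
  rw [h1, h3]
  rfl

/-- The annihilator `ann(G) = {f | f ∘ G = 0}` for the differentiation action. -/
noncomputable def ann (G : MvPolynomial σ k) : Ideal (MvPolynomial σ k) where
  carrier := {f | diffAction σ k f G = 0}
  add_mem' {f g} hf hg := by
    simp only [Set.mem_ofPred_eq] at hf hg ⊢
    rw [map_add, LinearMap.add_apply, hf, hg, add_zero]
  zero_mem' := by simp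
  smul_mem' c f hf := by
    simp only [Set.mem_ofPred_eq] at hf ⊢
    rw [smul_eq_mul, map_mul, Module.End.mul_apply, hf, map_zero]

end Action

/-! ### Generic forms -/

/-- `P` holds for a generic form of degree `e`: there is a nonzero polynomial `Φ` in the
coefficients such that `P G` holds for all forms `G` of degree `e` whose coefficients are not a
zero of `Φ`. Over an infinite field this is a nonempty Zariski open set of forms. The polynomial
`Φ` is asked to have integer coefficients, so that in characteristic zero all forms whose
coefficients are algebraically independent over the prime field are covered, too. -/
def HoldsForGenericForm {σ k : Type*} [Field k] (e : ℕ) (P : MvPolynomial σ k → Prop) : Prop :=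
  ∃ Φ : MvPolynomial {a : σ →₀ ℕ // a.degree = e} ℤ, Φ ≠ 0 ∧
    ∀ G : MvPolynomial σ k, G.IsHomogeneous e →
      aeval (fun a : {a : σ →₀ ℕ // a.degree = e} => G.coeff a.1) Φ ≠ 0 → P G

/-! ### The explicit Gröbner bases

The ring is `k[x_1, …, x_{n+1}]`, with variables indexed by `Fin (n + 1)`; the last variable has
index `Fin.last n`. -/

section Bases

variable (k : Type*) [Field k]

/-- The linear map `φ` with `φ(x^a) = x^a / ∏ i, (a i)!`. -/
noncomputable def phi (N : ℕ) : MvPolynomial (Fin N) k →ₗ[k] MvPolynomial (Fin N) k :=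
  (basisMonomials (Fin N) k).constr k
    fun a => monomial a ((∏ i, ((a i).factorial : k))⁻¹)

theorem phi_monomial (N : ℕ) (a : Fin N →₀ ℕ) :
    phi k N (monomial a 1) = monomial a ((∏ i, ((a i).factorial : k))⁻¹) := by
  have := (basisMonomials (Fin N) k).constr_basis k
    (fun a => monomial a ((∏ i, ((a i).factorial : k))⁻¹)) a
  rwa [coe_basisMonomials] at this

/-- The polynomial `F_a = ∏ i, (x_i - x_last)^(a i)`, the product being over all the variables
but the last one. -/
noncomputable def formF (n : ℕ) (a : Fin n → ℕ) : MvPolynomial (Fin (n + 1)) k :=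
  ∏ i, (X i.castSucc - X (Fin.last n)) ^ a i

/-- The set `{φ(F_a) : |a| = d + 1} ∪ {φ(x_last^(2i+1) F_a) : i = 0, …, d and |a| = d - i}`. -/
def evenBasis (n d : ℕ) : Set (MvPolynomial (Fin (n + 1)) k) :=
  {f | ∃ a : Fin n → ℕ, ∑ j, a j = d + 1 ∧ f = phi k (n + 1) (formF k n a)} ∪
  {f | ∃ (i : ℕ) (a : Fin n → ℕ), i ≤ d ∧ i + ∑ j, a j = d ∧
    f = phi k (n + 1) (X (Fin.last n) ^ (2 * i + 1) * formF k n a)}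

/-- The set `{φ(x_last^(2i) F_a) : i = 0, …, d + 1 and |a| = d + 1 - i}`. -/
def oddBasis (n d : ℕ) : Set (MvPolynomial (Fin (n + 1)) k) :=
  {f | ∃ (i : ℕ) (a : Fin n → ℕ), i ≤ d + 1 ∧ i + ∑ j, a j = d + 1 ∧
    f = phi k (n + 1) (X (Fin.last n) ^ (2 * i) * formF k n a)}

end Bases

/-! ### Coefficients of the differentiation action -/

/-! After weighting coefficients by factorials, differentiation shifts exponents, so `f ∈ ann G` is
a linear system in the coefficients of `f` whose matrix has entries `(a + c)! G_(a + c)`. Degree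
reverse lexicographic order matches this system: among monomials of equal degree, larger powers of
the last variable are smaller. For a form of degree `e`, take the square blocks of the system with
rows and columns indexed by the exponents of degree `i ≤ e / 2`, shifted by `e - 2i` in the last
variable. If all these Hankel blocks are nonsingular, then the leading exponents of nonzero elements
of `ann G` are exactly the `u` with `e + 1 + u_last ≤ 2 |u|`. Injectivity of the blocks excludes the
other exponents (`degree_of_mem_ann`); surjectivity produces an element for each of these
(`exists_mem_ann_leadingTerm_eq`).

For `H_e` the blocks have entries `(c + c' + s)!`, and the Vandermonde identity turns them into sums
of squares with positive weights (`det_hankel_one_ne_zero`). The product of the block determinants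
of the generic form is therefore a nonzero integer polynomial, which serves as `Φ`.

For the explicit bases, the coefficients of `φ(f) ∘ H_e` are, up to factorials, values at `(1, …,
1)` of derivatives of `x^c f`. The form `x_last^b F_a` vanishes there to order `|a|`, so `φ` of it
annihilates `H_e` once `e + 1 ≤ 2 |a| + b` (`phi_mem_ann_hsymm`). Its leading exponent is `(a, b)`,
for which this is the same inequality as above. The listed sets are the minimal such pairs. -/

/-- The product of the factorials of the exponents. -/
def multiFactorial {σ : Type*} [Fintype σ] (a : σ →₀ ℕ) : ℕ := ∏ i, (a i).factorial

theorem exponent_induction {σ : Type*} {p : (σ →₀ ℕ) → Prop} (zero : p 0)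
    (add_single : ∀ a i, p a → p (a + Finsupp.single i 1)) (a : σ →₀ ℕ) : p a := by
  classical
  induction h : a.degree generalizing a with
  | zero => rwa [(Finsupp.degree_eq_zero_iff a).mp h]
  | succ d ih =>
    obtain ⟨i, hi⟩ : ∃ i, a i ≠ 0 := by
      by_contra! h0
      rw [show a = 0 from Finsupp.ext h0] at h
      simp at h
    have ha : a - Finsupp.single i 1 + Finsupp.single i 1 = a :=
      tsub_add_cancel_of_le (by simpa using Nat.one_le_iff_ne_zero.mpr hi)
    rw [← ha]
    refine add_single _ i (ih _ ?_)
    have := congrArg Finsupp.degree ha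
    rw [map_add, Finsupp.degree_single, h] at this
    omega

section Coefficients

variable {σ k : Type*} [Fintype σ] [Field k]

theorem multiFactorial_pos (a : σ →₀ ℕ) : 0 < multiFactorial a :=
  Finset.prod_pos fun i _ => (a i).factorial_pos

theorem cast_multiFactorial_ne_zero [CharZero k] (a : σ →₀ ℕ) : (multiFactorial a : k) ≠ 0 :=
  Nat.cast_ne_zero.mpr (multiFactorial_pos a).ne'

theorem multiFactorial_add_single (a : σ →₀ ℕ) (i : σ) :
    multiFactorial (a + Finsupp.single i 1) = (a i + 1) * multiFactorial a := by
  classical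
  unfold multiFactorial
  rw [← Finset.mul_prod_erase _ _ (Finset.mem_univ i),
    ← Finset.mul_prod_erase Finset.univ (fun j => (a j).factorial) (Finset.mem_univ i), ← mul_assoc]
  congr 1
  · simp [Nat.factorial_succ]
  · refine Finset.prod_congr rfl fun j hj => ?_
    simp [(Finset.ne_of_mem_erase hj).symm]

theorem diffAction_monomial_add_single (a : σ →₀ ℕ) (i : σ) (G : MvPolynomial σ k) :
    diffAction σ k (monomial (a + Finsupp.single i 1) 1) G =
      pderiv i (diffAction σ k (monomial a 1) G) := by
  rw [← diffAction_X, ← Module.End.mul_apply, ← map_mul, X, monomial_mul, add_comm a, one_mul]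

theorem diffAction_monomial_zero (G : MvPolynomial σ k) :
    diffAction σ k (monomial 0 1) G = G := by
  rw [show (monomial (0 : σ →₀ ℕ) (1 : k)) = 1 from rfl, map_one, Module.End.one_apply]

/-- The factorial weights absorb the falling factorials produced by differentiation, leaving a pure
shift of exponents. -/
theorem multiFactorial_mul_coeff_diffAction_monomial (a c : σ →₀ ℕ) (G : MvPolynomial σ k) :
    (multiFactorial c : k) * coeff c (diffAction σ k (monomial a 1) G) =
      multiFactorial (a + c) * coeff (a + c) G := by
  induction a using exponent_induction generalizing c with
  | zero => rw [diffAction_monomial_zero, zero_add]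
  | add_single a i ih =>
    rw [diffAction_monomial_add_single, coeff_pderiv, add_right_comm, add_assoc a, ← ih,
      multiFactorial_add_single]
    push_cast
    ring

theorem diffAction_monomial (a : σ →₀ ℕ) (r : k) (G : MvPolynomial σ k) :
    diffAction σ k (monomial a r) G = r • diffAction σ k (monomial a 1) G := by
  rw [← LinearMap.smul_apply, ← map_smul, smul_monomial, smul_eq_mul, mul_one]

theorem multiFactorial_mul_coeff_diffAction (f G : MvPolynomial σ k) (c : σ →₀ ℕ) :
    (multiFactorial c : k) * coeff c (diffAction σ k f G) =
      ∑ a ∈ f.support, coeff a f * (multiFactorial (a + c) * coeff (a + c) G) := by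
  conv_lhs => rw [f.as_sum]
  rw [map_sum, LinearMap.sum_apply, coeff_sum, Finset.mul_sum]
  refine Finset.sum_congr rfl fun a _ => ?_
  rw [diffAction_monomial, coeff_smul, smul_eq_mul, mul_left_comm,
    multiFactorial_mul_coeff_diffAction_monomial]

/-- The finite sum of `multiFactorial_mul_coeff_diffAction` over any finite set that contains the
exponents of the nonzero terms. -/
theorem multiFactorial_mul_coeff_diffAction_eq_sum (f G : MvPolynomial σ k) (c : σ →₀ ℕ)
    (T : Finset (σ →₀ ℕ)) (hT : ∀ a, coeff a f ≠ 0 → coeff (a + c) G ≠ 0 → a ∈ T) :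
    (multiFactorial c : k) * coeff c (diffAction σ k f G) =
      ∑ a ∈ T, coeff a f * (multiFactorial (a + c) * coeff (a + c) G) := by
  rw [multiFactorial_mul_coeff_diffAction, ← finsum_eq_sum_of_support_subset,
    ← finsum_eq_sum_of_support_subset]
  · intro a ha
    exact hT a (fun h => ha (by simp [h])) (fun h => ha (by simp [h]))
  · intro a ha
    exact mem_support_iff.mpr fun h => ha (by simp [h])

theorem mem_ann {f G : MvPolynomial σ k} : f ∈ ann G ↔ diffAction σ k f G = 0 := Iff.rfl

theorem mem_ann_iff_coeff [CharZero k] {f G : MvPolynomial σ k} :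
    f ∈ ann G ↔ ∀ c, (multiFactorial c : k) * coeff c (diffAction σ k f G) = 0 := by
  rw [mem_ann, MvPolynomial.ext_iff]
  refine forall_congr' fun c => ?_
  rw [mul_eq_zero, or_iff_right (cast_multiFactorial_ne_zero c), coeff_zero]

theorem monomial_mem_ann_of_lt [CharZero k] {G : MvPolynomial σ k} {e : ℕ}
    (hG : G.IsHomogeneous e) {u : σ →₀ ℕ} (hu : e < u.degree) : monomial u 1 ∈ ann G := by
  rw [mem_ann_iff_coeff]
  intro c
  rw [multiFactorial_mul_coeff_diffAction_monomial, hG.coeff_eq_zero, mul_zero]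
  rw [map_add]
  omega

/-! ### Complete symmetric polynomials -/

theorem coeff_hsymm [DecidableEq σ] (e : ℕ) (a : σ →₀ ℕ) :
    coeff a (hsymm σ k e) = if a.degree = e then 1 else 0 := by
  have h : ∀ s : Multiset σ, (s.map (X : σ → MvPolynomial σ k)).prod =
      monomial (Multiset.toFinsupp s) 1 := by
    intro s
    induction s using Multiset.induction_on with
    | empty => simp
    | cons i s ih =>
      rw [Multiset.map_cons, Multiset.prod_cons, ih, X, monomial_mul, one_mul,
        ← Multiset.singleton_add, map_add, Multiset.toFinsupp_singleton]
  have hdeg : a.degree = (Finsupp.toMultiset a).card := by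
    rw [Finsupp.card_toMultiset]; rfl
  have hsum : hsymm σ k e = ∑ s : Sym σ e, monomial (Multiset.toFinsupp (s : Multiset σ)) 1 :=
    Finset.sum_congr rfl fun s _ => h s
  simp only [hsum, coeff_sum, coeff_monomial]
  split_ifs with ha
  · rw [Finset.sum_eq_single (Sym.mk (Finsupp.toMultiset a) (hdeg.symm.trans ha))]
    · simp
    · intro s _ hs
      refine if_neg fun hsa => hs ?_
      apply Sym.coe_injective
      simp [← hsa]
    · simp
  · refine Finset.sum_eq_zero fun s _ => if_neg fun hsa => ha ?_
    rw [hdeg, ← hsa, Multiset.toFinsupp_toMultiset]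
    exact s.2

theorem isHomogeneous_hsymm [DecidableEq σ] (e : ℕ) : (hsymm σ k e).IsHomogeneous e := by
  intro a ha
  rw [coeff_hsymm] at ha
  by_contra h
  refine ha (if_neg fun h' => h ?_)
  rw [← h', Finsupp.degree_eq_weight_one]
  rfl

/-! ### Differential operators and powers of ideals -/

/-- By the Leibniz rule, a derivation lowers the order of vanishing by at most one. -/
theorem Derivation.apply_mem_pow {R A : Type*} [CommRing R] [CommRing A] [Algebra R A]
    (D : Derivation R A A) (I : Ideal A) (m : ℕ) {f : A} (hf : f ∈ I ^ (m + 1)) :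
    D f ∈ I ^ m := by
  induction m generalizing f with
  | zero => simp
  | succ m ih =>
    rw [pow_succ] at hf
    refine Submodule.mul_induction_on hf (fun a ha b hb => ?_) (fun a b ha hb => ?_)
    · rw [D.leibniz]
      refine add_mem (Ideal.mul_mem_right _ _ ha) ?_
      rw [pow_succ, mul_comm, smul_eq_mul, mul_comm, mul_comm (I ^ m)]
      exact Ideal.mul_mem_mul hb (ih ha)
    · rw [map_add]
      exact add_mem ha hb

theorem diffAction_monomial_mem_pow (I : Ideal (MvPolynomial σ k)) (c : σ →₀ ℕ) (m : ℕ)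
    {f : MvPolynomial σ k} (hf : f ∈ I ^ (m + c.degree)) :
    diffAction σ k (monomial c 1) f ∈ I ^ m := by
  induction c using exponent_induction generalizing m with
  | zero => simpa [diffAction_monomial_zero] using hf
  | add_single c i ih =>
    rw [diffAction_monomial_add_single]
    refine (pderiv i).apply_mem_pow I m (ih _ ?_)
    rwa [map_add, Finsupp.degree_single, ← add_assoc, add_right_comm] at hf

theorem multiFactorial_smul_diffAction_monomial [CharZero k] (a c : σ →₀ ℕ) :
    (multiFactorial a : k) • diffAction σ k (monomial c 1) (monomial (a + c) 1) =
      monomial a (multiFactorial (a + c) : k) := by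
  classical
  ext b
  have h := multiFactorial_mul_coeff_diffAction_monomial c b (monomial (a + c) (1 : k))
  rw [coeff_smul, smul_eq_mul, coeff_monomial]
  rw [coeff_monomial, add_comm c b] at h
  by_cases hab : a = b
  · subst hab
    simpa using h
  · rw [if_neg hab, mul_eq_zero]
    rw [if_neg (by simpa using hab), mul_zero, mul_eq_zero] at h
    exact Or.inr (h.resolve_left (cast_multiFactorial_ne_zero b))

/-- Up to factorials, the coefficients of `diffAction f (∑ X^a)` are values at `(1, …, 1)` of
derivatives of `x^c f`. -/
theorem eval_one_diffAction_monomial_mul [CharZero k] (f : MvPolynomial σ k) (c : σ →₀ ℕ) :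
    eval 1 (diffAction σ k (monomial c 1) (monomial c 1 * f)) =
      ∑ a ∈ f.support, coeff a f * ((multiFactorial (a + c) : k) / multiFactorial a) := by
  conv_lhs => rw [f.as_sum]
  rw [Finset.mul_sum, map_sum, map_sum]
  refine Finset.sum_congr rfl fun a _ => ?_
  have h := congrArg (eval (1 : σ → k)) (multiFactorial_smul_diffAction_monomial (k := k) a c)
  rw [smul_eval, eval_monomial] at h
  rw [monomial_mul, one_mul, add_comm c a, ← mul_one (coeff a f), ← smul_eq_mul (coeff a f),
    ← smul_monomial, map_smul, smul_eval, smul_eq_mul, mul_one,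
    eq_div_of_mul_eq (cast_multiFactorial_ne_zero a) ((mul_comm _ _).trans h)]
  simp

end Coefficients

/-! ### Annihilation of `H_e` from vanishing at `(1, …, 1)` -/

section AnnihilatorHsymm

variable (k : Type*) [Field k]

theorem coeff_phi (N : ℕ) (f : MvPolynomial (Fin N) k) (a : Fin N →₀ ℕ) :
    coeff a (phi k N f) = coeff a f / multiFactorial a := by
  induction f using MvPolynomial.induction_on' with
  | monomial b r =>
    rw [← mul_one r, ← smul_eq_mul, ← smul_monomial, map_smul, phi_monomial, coeff_smul,
      coeff_smul, coeff_monomial, coeff_monomial]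
    split_ifs with h
    · subst h
      simp [multiFactorial, div_eq_mul_inv]
    · simp
  | add f g hf hg => rw [map_add, coeff_add, coeff_add, hf, hg, add_div]

theorem support_phi [CharZero k] (N : ℕ) (f : MvPolynomial (Fin N) k) : (phi k N f).support = f.support := by
  ext a
  simp [mem_support_iff, coeff_phi, (multiFactorial_pos a).ne']

variable {k}

/-- A form of degree `j` that vanishes to order more than `e - j` at the point `(1 : … : 1)` is
mapped by `φ` into the annihilator of the complete symmetric polynomial. -/
theorem phi_mem_ann_hsymm [CharZero k] {N e j m : ℕ} {f : MvPolynomial (Fin N) k} (hf : f.IsHomogeneous j)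
    (hmem : f ∈ (RingHom.ker (eval (1 : Fin N → k))) ^ m) (h : e < j + m) :
    phi k N f ∈ ann (hsymm (Fin N) k e) := by
  rw [mem_ann_iff_coeff]
  intro c
  rw [multiFactorial_mul_coeff_diffAction, support_phi]
  by_cases hc : j + c.degree = e
  · have hD : diffAction (Fin N) k (monomial c 1) (monomial c 1 * f) ∈
        (RingHom.ker (eval (1 : Fin N → k))) ^ 1 := by
      refine diffAction_monomial_mem_pow _ c 1 (Ideal.pow_le_pow_right (show 1 + c.degree ≤ m by omega) ?_)
      exact Ideal.mul_mem_left _ _ hmem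
    rw [pow_one, RingHom.mem_ker, eval_one_diffAction_monomial_mul] at hD
    rw [← hD]
    refine Finset.sum_congr rfl fun a ha => ?_
    have hdeg : a.degree = j := by
      by_contra hne
      exact mem_support_iff.mp ha (hf.coeff_eq_zero hne)
    rw [coeff_phi, coeff_hsymm, if_pos (by rw [map_add, hdeg, hc])]
    ring
  · refine Finset.sum_eq_zero fun a ha => ?_
    have hdeg : a.degree = j := by
      by_contra hne
      exact mem_support_iff.mp ha (hf.coeff_eq_zero hne)
    rw [coeff_hsymm, if_neg (by rwa [map_add, hdeg])]
    simp

end AnnihilatorHsymm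

/-! ### Hankel matrices -/

noncomputable instance fintypeExponentsOfDegree {σ : Type*} [Finite σ] (i : ℕ) :
    Fintype {a : σ →₀ ℕ // a.degree = i} :=
  (Finsupp.finite_of_degree_eq i).fintype

/-- The Hankel matrix with entries `(c + c' + s)! γ (c + c' + s)`, where `c` and `c'` are exponents
of degree `i`. -/
noncomputable def hankel {σ A : Type*} [Fintype σ] [CommRing A] (γ : (σ →₀ ℕ) → A) (i : ℕ) (s : σ →₀ ℕ) :
    Matrix {a : σ →₀ ℕ // a.degree = i} {a : σ →₀ ℕ // a.degree = i} A :=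
  Matrix.of fun c c' => (multiFactorial (c.1 + c'.1 + s) : A) * γ (c.1 + c'.1 + s)

theorem map_det_hankel {σ A B : Type*} [Fintype σ] [DecidableEq σ] [CommRing A] [CommRing B]
    (f : A →+* B) (γ : (σ →₀ ℕ) → A) (i : ℕ) (s : σ →₀ ℕ) :
    f (hankel γ i s).det = (hankel (f ∘ γ) i s).det := by
  rw [RingHom.map_det]
  congr 1
  ext c c'
  simp [hankel]

/-- Vandermonde's identity for the binomial coefficient `(c + c' + s).choose c'`. Each summand is a
weight depending on `m` times the same function at `c` and at `c'`. The range is bounded by `i`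
rather than `c'` so that all matrix entries share one index set. -/
theorem factorial_add_add_eq_sum (c c' s i : ℕ) (h : c' ≤ i) :
    ((c + c' + s).factorial : ℚ) = ∑ m ∈ Finset.range (i + 1),
      ((m.factorial * (m + s).factorial : ℕ) : ℚ)⁻¹ *
        (((c.descFactorial m * (c + s).factorial : ℕ) : ℚ) *
          ((c'.descFactorial m * (c' + s).factorial : ℕ) : ℚ)) := by
  have hsub : Finset.range (c' + 1) ⊆ Finset.range (i + 1) := by
    simpa using h
  rw [← Finset.sum_subset hsub]
  · have h1 : (c + c' + s).factorial =
        (c + (c' + s)).choose c' * c'.factorial * (c + s).factorial := by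
      rw [← add_assoc, ← Nat.choose_mul_factorial_mul_factorial (show c' ≤ c + c' + s by omega)]
      congr 2
      omega
    rw [h1, Nat.add_choose_eq, Finset.Nat.sum_antidiagonal_eq_sum_range_succ_mk]
    push_cast
    rw [Finset.sum_mul, Finset.sum_mul]
    refine Finset.sum_congr rfl fun m hm => ?_
    have hm' : m ≤ c' := by simpa [Nat.lt_succ_iff] using hm
    have h2 := Nat.choose_mul_factorial_mul_factorial (show c' - m ≤ c' + s by omega)
    rw [show c' + s - (c' - m) = m + s by omega] at h2
    have h3 := Nat.factorial_mul_descFactorial hm'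
    have h4 := Nat.descFactorial_eq_factorial_mul_choose c m
    rw [h4, ← h2, ← h3]
    have := Nat.cast_ne_zero (R := ℚ).mpr (m.factorial_ne_zero)
    have := Nat.cast_ne_zero (R := ℚ).mpr ((m + s).factorial_ne_zero)
    push_cast
    field_simp
  · intro m _ hm
    have : c'.descFactorial m = 0 := Nat.descFactorial_eq_zero_iff_lt.mpr (by
      simpa [Nat.lt_succ_iff] using hm)
    simp [this]

section Nonsingular

variable {σ : Type*} [Fintype σ]

/-- The triangular factor in the decomposition of the Hankel matrix of the constant function. -/
def hankelFactor (s : σ →₀ ℕ) (m : σ → ℕ) (c : σ →₀ ℕ) : ℕ :=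
  ∏ l, (c l).descFactorial (m l) * (c l + s l).factorial

theorem hankelFactor_ne_zero_iff (s : σ →₀ ℕ) (m : σ → ℕ) (c : σ →₀ ℕ) :
    hankelFactor s m c ≠ 0 ↔ ∀ l, m l ≤ c l := by
  simp [hankelFactor, Finset.prod_ne_zero_iff, Nat.factorial_ne_zero]

/-- The weight in the decomposition of the Hankel matrix of the constant function. -/
def hankelWeight (s : σ →₀ ℕ) (m : σ → ℕ) : ℚ :=
  ∏ l, (((m l).factorial * (m l + s l).factorial : ℕ) : ℚ)⁻¹

theorem hankelWeight_pos (s : σ →₀ ℕ) (m : σ → ℕ) : 0 < hankelWeight s m :=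
  Finset.prod_pos fun _ _ => inv_pos.mpr (Nat.cast_pos.mpr
    (Nat.mul_pos (Nat.factorial_pos _) (Nat.factorial_pos _)))

theorem multiFactorial_add_add_eq_sum [DecidableEq σ] (s c c' : σ →₀ ℕ) {i : ℕ}
    (h : c'.degree = i) :
    (multiFactorial (c + c' + s) : ℚ) =
      ∑ m ∈ Fintype.piFinset fun _ : σ => Finset.range (i + 1),
        hankelWeight s m * (hankelFactor s m c * hankelFactor s m c') := by
  have h' : ∀ l, c' l ≤ i := fun l => h ▸ Finsupp.le_degree l c'
  simp only [multiFactorial, hankelWeight, hankelFactor]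
  push_cast
  simp only [← Finset.prod_mul_distrib]
  rw [← Finset.prod_univ_sum (fun _ => Finset.range (i + 1)) (fun l m =>
    ((m.factorial : ℚ) * (m + s l).factorial)⁻¹ * (((c l).descFactorial m * (c l + s l).factorial)
      * ((c' l).descFactorial m * (c' l + s l).factorial)))]
  refine Finset.prod_congr rfl fun l _ => ?_
  change ((c l + c' l + s l).factorial : ℚ) = _
  rw [factorial_add_add_eq_sum (c l) (c' l) (s l) i (h' l)]
  push_cast
  rfl

/-- The Hankel matrix of the constant function is positive definite over `ℚ`, so nonsingular. -/
theorem det_hankel_one_ne_zero [DecidableEq σ] (i : ℕ) (s : σ →₀ ℕ) :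
    (hankel (fun _ : σ →₀ ℕ => (1 : ℚ)) i s).det ≠ 0 := by
  rw [Ne, ← Matrix.exists_mulVec_eq_zero_iff]
  rintro ⟨v, hv, hMv⟩
  apply hv
  -- The quadratic form of the matrix at `v`, written as a positively weighted sum of squares of
  -- linear forms.
  have hq : ∑ m ∈ Fintype.piFinset fun _ : σ => Finset.range (i + 1),
      hankelWeight s m * (∑ c : {a : σ →₀ ℕ // a.degree = i}, hankelFactor s m c.1 * v c) ^ 2
        = 0 := by
    have h0 : v ⬝ᵥ (hankel (fun _ : σ →₀ ℕ => (1 : ℚ)) i s).mulVec v = 0 := by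
      rw [hMv, dotProduct_zero]
    rw [← h0]
    simp only [dotProduct, Matrix.mulVec, hankel, Matrix.of_apply, mul_one,
      Finset.mul_sum, sq, Finset.sum_mul]
    rw [Finset.sum_comm]
    refine Finset.sum_congr rfl fun c _ => ?_
    rw [Finset.sum_comm]
    refine Finset.sum_congr rfl fun c' _ => ?_
    rw [multiFactorial_add_add_eq_sum s c.1 c'.1 c'.2, Finset.sum_mul, Finset.mul_sum]
    refine Finset.sum_congr rfl fun m _ => ?_
    ring
  rw [Finset.sum_eq_zero_iff_of_nonneg fun m _ =>
    mul_nonneg (hankelWeight_pos s m).le (sq_nonneg _)] at hq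
  funext b
  -- The linear form with index `m = b` involves only the `c` with `b ≤ c`. Since all exponents have
  -- degree `i`, only `c = b` survives, and the form reduces to a nonzero multiple of `v b`.
  have hb := hq (b.1 : σ → ℕ) (by
    rw [Fintype.mem_piFinset]
    intro l
    rw [Finset.mem_range, Nat.lt_succ_iff]
    exact (Finsupp.le_degree l b.1).trans b.2.le)
  rw [mul_eq_zero, or_iff_right (hankelWeight_pos s _).ne', sq_eq_zero_iff,
    Finset.sum_eq_single b, mul_eq_zero, or_iff_right] at hb
  · exact hb
  · exact Nat.cast_ne_zero.mpr ((hankelFactor_ne_zero_iff _ _ _).mpr fun l => le_rfl)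
  · intro c _ hcb
    rw [mul_eq_zero, Nat.cast_eq_zero]
    left
    by_contra hne
    have hle : b.1 ≤ c.1 := (hankelFactor_ne_zero_iff _ _ _).mp hne
    obtain ⟨d, hd⟩ := exists_add_of_le hle
    have := congrArg Finsupp.degree hd
    rw [map_add, b.2, c.2] at this
    have hd0 : d = 0 := (Finsupp.degree_eq_zero_iff d).mp (by omega)
    exact hcb (Subtype.ext (by rw [hd, hd0, add_zero]))
  · simp

theorem intCast_det_hankel_one [DecidableEq σ] (A : Type*) [CommRing A] (i : ℕ) (s : σ →₀ ℕ) :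
    (((hankel (fun _ : σ →₀ ℕ => (1 : ℤ)) i s).det : ℤ) : A) =
      (hankel (fun _ : σ →₀ ℕ => (1 : A)) i s).det := by
  rw [← eq_intCast (Int.castRingHom A), map_det_hankel]
  congr 2
  funext
  simp

theorem det_hankel_one_ne_zero_of_charZero [DecidableEq σ] {A : Type*} [CommRing A] [CharZero A]
    (i : ℕ) (s : σ →₀ ℕ) : (hankel (fun _ : σ →₀ ℕ => (1 : A)) i s).det ≠ 0 := by
  have hQ := det_hankel_one_ne_zero (σ := σ) i s
  rw [← intCast_det_hankel_one] at hQ ⊢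
  simpa using hQ

end Nonsingular

/-! ### The initial ideal of the annihilator of a form with nonsingular Hankel matrices -/

theorem degRevLex_le_last {n : ℕ} {a b : Fin (n + 1) →₀ ℕ}
    (h : (degRevLex (Fin (n + 1))).toSyn a ≤ (degRevLex (Fin (n + 1))).toSyn b)
    (hd : a.degree = b.degree) : b (Fin.last n) ≤ a (Fin.last n) := by
  rcases h.lt_or_eq with h | h
  · rcases (DegRevLex.lt_iff a b).mp h with h | ⟨-, i, hi, hlt⟩
    · omega
    · rcases (Fin.le_last i).lt_or_eq with h' | rfl
      · exact (hi _ h').ge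
      · exact hlt.le
  · rw [(degRevLex (Fin (n + 1))).toSyn.injective h]

theorem degRevLex_lt_of_last_lt {n : ℕ} {a b : Fin (n + 1) →₀ ℕ} (hd : a.degree = b.degree)
    (h : b (Fin.last n) < a (Fin.last n)) :
    (degRevLex (Fin (n + 1))).toSyn a < (degRevLex (Fin (n + 1))).toSyn b :=
  (DegRevLex.lt_iff a b).mpr
    (Or.inr ⟨hd, Fin.last n, fun j hj => absurd hj (Fin.le_last j).not_gt, h⟩)

section Forms

variable {k : Type*} [Field k] [CharZero k]

/-- The equations of `f ∈ ann G` at exponents `c + t'` with `|c| = i` involve only terms of `f` of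
degree `i + |t|`. By `hsupp` these are divisible by `x^t`, so their coefficients form a kernel
vector of the square Hankel matrix. -/
theorem coeff_add_eq_zero_of_det_hankel_ne_zero {σ : Type*} [Fintype σ] [DecidableEq σ]
    {G : MvPolynomial σ k} {e i : ℕ} (hG : G.IsHomogeneous e) {s t t' : σ →₀ ℕ} (hs : t + t' = s)
    (he : e = 2 * i + s.degree) (hdet : (hankel (fun a => coeff a G) i s).det ≠ 0)
    {f : MvPolynomial σ k} (hf : f ∈ ann G)
    (hsupp : ∀ a, coeff a f ≠ 0 → a.degree = i + t.degree → t ≤ a)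
    {c : σ →₀ ℕ} (hc : c.degree = i) : coeff (c + t) f = 0 := by
  have hM : (hankel (fun a => coeff a G) i s).mulVec (fun c => coeff (c.1 + t) f) = 0 := by
    funext c
    let T : Finset (σ →₀ ℕ) := Finset.univ.map
      ⟨fun c' : {a : σ →₀ ℕ // a.degree = i} => c'.1 + t,
        fun x y h => Subtype.ext (add_right_cancel h)⟩
    have h := multiFactorial_mul_coeff_diffAction_eq_sum f G (c.1 + t') T (by
      intro a ha hG'
      have hd : (a + (c.1 + t')).degree = e := by
        by_contra hne
        exact hG' (hG.coeff_eq_zero hne)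
      rw [map_add, map_add, c.2, he, ← hs, map_add] at hd
      obtain ⟨b, rfl⟩ := exists_add_of_le (hsupp a ha (by omega))
      rw [map_add] at hd
      exact Finset.mem_map.mpr ⟨⟨b, by omega⟩, Finset.mem_univ _, add_comm _ _⟩)
    rw [mem_ann_iff_coeff.mp hf, Finset.sum_map] at h
    rw [Pi.zero_apply, h]
    refine Finset.sum_congr rfl fun c' _ => ?_
    have hadd : c'.1 + t + (c.1 + t') = c.1 + c'.1 + s := by
      rw [← hs]
      abel
    change (multiFactorial (c.1 + c'.1 + s) : k) * coeff (c.1 + c'.1 + s) G * coeff (c'.1 + t) f =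
      coeff (c'.1 + t) f * (multiFactorial (c'.1 + t + (c.1 + t')) *
        coeff (c'.1 + t + (c.1 + t')) G)
    rw [hadd]
    ring
  have hv := Matrix.eq_zero_of_mulVec_eq_zero hdet hM
  exact congrFun hv ⟨c, hc⟩

variable {n e : ℕ} {G : MvPolynomial (Fin (n + 1)) k}

theorem degree_of_mem_ann (hG : G.IsHomogeneous e)
    (hdet : ∀ i, 2 * i ≤ e →
      (hankel (fun a => coeff a G) i (Finsupp.single (Fin.last n) (e - 2 * i))).det ≠ 0)
    {f : MvPolynomial (Fin (n + 1)) k} (hf : f ∈ ann G) (hf0 : f ≠ 0) :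
    e + 1 + (degRevLex (Fin (n + 1))).degree f (Fin.last n) ≤
      2 * ((degRevLex (Fin (n + 1))).degree f).degree := by
  set u := (degRevLex (Fin (n + 1))).degree f with hu
  have hfu : coeff u f ≠ 0 := (degRevLex (Fin (n + 1))).coeff_degree_ne_zero_iff.mpr hf0
  have hle : ∀ a, coeff a f ≠ 0 → a.degree = u.degree → u (Fin.last n) ≤ a (Fin.last n) :=
    fun a ha hd => degRevLex_le_last
      ((degRevLex (Fin (n + 1))).le_degree (mem_support_iff.mpr ha)) hd
  by_contra! hlt
  have hun := Finsupp.le_degree (Fin.last n) u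
  apply hfu
  -- Up to the middle degree the whole shift goes into the equations (`t = 0`). Above it the shift
  -- goes into `f`: all terms of degree `|u|` share the factor `x_last^(2|u| - e)`, because `2|u| -
  -- e ≤ u_last` and no last exponent among them is below `u_last`.
  by_cases hj : 2 * u.degree ≤ e
  · have := coeff_add_eq_zero_of_det_hankel_ne_zero hG (zero_add _)
      (by rw [Finsupp.degree_single]; omega) (hdet _ hj) hf (fun _ _ _ => zero_le) (c := u) rfl
    rwa [add_zero] at this
  · have hs : Finsupp.single (Fin.last n) (2 * u.degree - e) ≤ u := by
      rw [Finsupp.single_le_iff]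
      omega
    obtain ⟨c, hc⟩ := exists_add_of_le hs
    have hcd : c.degree = e - u.degree := by
      have := congrArg Finsupp.degree hc
      rw [map_add, Finsupp.degree_single] at this
      omega
    have he : e - 2 * (e - u.degree) = 2 * u.degree - e := by omega
    have hdet' := hdet (e - u.degree) (by omega)
    rw [he] at hdet'
    have key : coeff (c + Finsupp.single (Fin.last n) (2 * u.degree - e)) f = 0 := by
      refine coeff_add_eq_zero_of_det_hankel_ne_zero hG (add_zero _)
        (by rw [Finsupp.degree_single]; omega) hdet' hf (fun a ha hd => ?_) hcd
      rw [Finsupp.degree_single] at hd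
      rw [Finsupp.single_le_iff]
      have := hle a ha (by omega)
      omega
    rwa [add_comm c, ← hc] at key

theorem exists_mem_ann_leadingTerm_eq (hG : G.IsHomogeneous e)
    (hdet : ∀ i, 2 * i ≤ e →
      (hankel (fun a => coeff a G) i (Finsupp.single (Fin.last n) (e - 2 * i))).det ≠ 0)
    {u : Fin (n + 1) →₀ ℕ} (hu : e + 1 + u (Fin.last n) ≤ 2 * u.degree) :
    ∃ f ∈ ann G, (degRevLex (Fin (n + 1))).leadingTerm f = monomial u 1 := by
  classical
  rcases lt_or_ge e u.degree with hj | hj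
  · exact ⟨monomial u 1, monomial_mem_ann_of_lt hG hj, MonomialOrder.leadingTerm_monomial _ _⟩
  obtain ⟨i, hi⟩ : ∃ i, e = u.degree + i := exists_add_of_le hj
  have hdet' := hdet i (by omega)
  set s : Fin (n + 1) →₀ ℕ := Finsupp.single (Fin.last n) (e - 2 * i) with hs
  set M := hankel (fun a => coeff a G) i s with hM
  -- The vector `v` corrects `x^u` by terms divisible by `x_last^(e - 2i)` so that the sum
  -- annihilates `G`.
  obtain ⟨v, hv⟩ : ∃ v, M.mulVec v =
      fun c => -((multiFactorial (u + c.1) : k) * coeff (u + c.1) G) := by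
    refine ⟨M⁻¹.mulVec
      (fun c => -((multiFactorial (u + c.1) : k) * coeff (u + c.1) G)), ?_⟩
    rw [Matrix.mulVec_mulVec, Matrix.mul_nonsing_inv _ (isUnit_iff_ne_zero.mpr hdet'),
      Matrix.one_mulVec]
  set r : MvPolynomial (Fin (n + 1)) k :=
    ∑ c : {a : Fin (n + 1) →₀ ℕ // a.degree = i}, monomial (c.1 + s) (v c) with hr
  have hsd : s.degree = e - 2 * i := Finsupp.degree_single _ _
  have hcs : ∀ c : {a : Fin (n + 1) →₀ ℕ // a.degree = i}, (c.1 + s).degree = u.degree := by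
    intro c
    rw [map_add, c.2, hsd]
    omega
  have hmem : monomial u 1 + r ∈ ann G := by
    rw [mem_ann_iff_coeff]
    intro c
    rw [map_add, LinearMap.add_apply, coeff_add, mul_add,
      multiFactorial_mul_coeff_diffAction_monomial, hr, map_sum, LinearMap.sum_apply, coeff_sum,
      Finset.mul_sum]
    by_cases hc : c.degree = i
    · have hrow := congrFun hv ⟨c, hc⟩
      rw [← neg_eq_iff_eq_neg.mpr hrow, neg_add_eq_zero]
      refine Finset.sum_congr rfl fun c' _ => ?_
      rw [diffAction_monomial, coeff_smul, smul_eq_mul, mul_left_comm,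
        multiFactorial_mul_coeff_diffAction_monomial, mul_comm (v c')]
      have hadd : c'.1 + s + c = c + c'.1 + s := by abel
      simp only [hM, hankel, Matrix.of_apply, hadd]
    · rw [hG.coeff_eq_zero (by rw [map_add]; omega), mul_zero, zero_add]
      refine Finset.sum_eq_zero fun c' _ => ?_
      rw [diffAction_monomial, coeff_smul, smul_eq_mul, mul_left_comm,
        multiFactorial_mul_coeff_diffAction_monomial,
        hG.coeff_eq_zero (by rw [map_add, hcs]; omega), mul_zero, mul_zero]
  refine ⟨_, hmem, ?_⟩
  -- The correction `r` may be zero, with leading exponent `0` by convention, so the strict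
  -- comparison needs `u ≠ 0`.
  have hu0 : 0 < (degRevLex (Fin (n + 1))).toSyn u := by
    refine lt_of_le_of_ne ((degRevLex (Fin (n + 1))).zero_le _) (Ne.symm ?_)
    rw [Ne, EmbeddingLike.map_eq_zero_iff]
    rintro rfl
    simp at hu
  have hlt : (degRevLex (Fin (n + 1))).toSyn ((degRevLex (Fin (n + 1))).degree r) <
      (degRevLex (Fin (n + 1))).toSyn
        ((degRevLex (Fin (n + 1))).degree (monomial u (1 : k))) := by
    rw [MonomialOrder.degree_monomial, if_neg one_ne_zero,
      MonomialOrder.degree_lt_iff (by simpa using hu0)]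
    intro b hb
    obtain ⟨c, -, hc⟩ : ∃ c ∈ Finset.univ, coeff b (monomial (c.1 + s) (v c)) ≠ 0 := by
      rw [mem_support_iff, hr, coeff_sum] at hb
      exact Finset.exists_ne_zero_of_sum_ne_zero hb
    obtain rfl : c.1 + s = b := by
      by_contra hne
      exact hc (by rw [coeff_monomial, if_neg hne])
    -- The shift is `e - 2i = 2|u| - e`, which exceeds `u_last` by the hypothesis on `u`.
    refine degRevLex_lt_of_last_lt (hcs c) ?_
    rw [Finsupp.add_apply, hs, Finsupp.single_eq_same]
    omega
  rw [MonomialOrder.leadingTerm, MonomialOrder.degree_add_of_lt hlt,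
    MonomialOrder.leadingCoeff_add_of_lt hlt, MonomialOrder.leadingCoeff_monomial,
    MonomialOrder.degree_monomial, if_neg one_ne_zero]

theorem initialIdeal_ann_eq_span (hG : G.IsHomogeneous e)
    (hdet : ∀ i, 2 * i ≤ e →
      (hankel (fun a => coeff a G) i (Finsupp.single (Fin.last n) (e - 2 * i))).det ≠ 0) :
    initialIdeal (degRevLex (Fin (n + 1))) (ann G) =
      Ideal.span ((fun u => monomial u (1 : k)) ''
        {u | e + 1 + u (Fin.last n) ≤ 2 * u.degree}) := by
  apply le_antisymm
  · rw [initialIdeal, Ideal.span_le]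
    rintro _ ⟨f, hf, rfl⟩
    by_cases hf0 : f = 0
    · simp [hf0]
    · rw [SetLike.mem_coe, MonomialOrder.leadingTerm, ← mul_one (MonomialOrder.leadingCoeff _ f),
        ← C_mul_monomial]
      exact Ideal.mul_mem_left _ _
        (Ideal.subset_span ⟨_, degree_of_mem_ann hG hdet hf hf0, rfl⟩)
  · rw [Ideal.span_le]
    rintro _ ⟨u, hu, rfl⟩
    obtain ⟨f, hf, hfu⟩ := exists_mem_ann_leadingTerm_eq hG hdet hu
    exact Ideal.subset_span ⟨f, hf, hfu⟩

end Forms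

/-! ### Genericity of the Hankel condition -/

section HankelHsymm

variable {k : Type*} [Field k]

theorem det_hankel_coeff_hsymm_ne_zero [CharZero k] {n e i : ℕ} (hi : 2 * i ≤ e) :
    (hankel (fun a => coeff a (hsymm (Fin (n + 1)) k e)) i
      (Finsupp.single (Fin.last n) (e - 2 * i))).det ≠ 0 := by
  have h : hankel (fun a => coeff a (hsymm (Fin (n + 1)) k e)) i
      (Finsupp.single (Fin.last n) (e - 2 * i)) =
      hankel (fun _ => (1 : k)) i (Finsupp.single (Fin.last n) (e - 2 * i)) := by
    ext c c'
    simp only [hankel, Matrix.of_apply]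
    rw [coeff_hsymm, if_pos]
    rw [map_add, map_add, c.2, c'.2, Finsupp.degree_single]
    omega
  rw [h]
  exact det_hankel_one_ne_zero_of_charZero _ _

/-- The coefficients of the generic form of degree `e`. -/
noncomputable def genericCoeff (σ : Type*) (e : ℕ) (a : σ →₀ ℕ) :
    MvPolynomial {a : σ →₀ ℕ // a.degree = e} ℤ :=
  if h : a.degree = e then X ⟨a, h⟩ else 0

/-- The product of the determinants of the Hankel matrices of the generic form of degree `e`. -/
noncomputable def hankelDetProd (n e : ℕ) :
    MvPolynomial {a : Fin (n + 1) →₀ ℕ // a.degree = e} ℤ :=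
  ∏ i ∈ Finset.range (e / 2 + 1),
    (hankel (genericCoeff (Fin (n + 1)) e) i (Finsupp.single (Fin.last n) (e - 2 * i))).det

theorem aeval_hankelDetProd {n e : ℕ} {G : MvPolynomial (Fin (n + 1)) k}
    (hG : G.IsHomogeneous e) :
    aeval (fun a : {a : Fin (n + 1) →₀ ℕ // a.degree = e} => coeff a.1 G) (hankelDetProd n e) =
      ∏ i ∈ Finset.range (e / 2 + 1),
        (hankel (fun a => coeff a G) i (Finsupp.single (Fin.last n) (e - 2 * i))).det := by
  rw [hankelDetProd, map_prod]
  refine Finset.prod_congr rfl fun i _ => ?_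
  have h := map_det_hankel (aeval (R := ℤ)
    (fun a : {a : Fin (n + 1) →₀ ℕ // a.degree = e} => coeff a.1 G)).toRingHom
    (genericCoeff (Fin (n + 1)) e) i (Finsupp.single (Fin.last n) (e - 2 * i))
  refine h.trans ?_
  congr 2
  funext a
  by_cases ha : a.degree = e
  · simp [genericCoeff, ha]
  · simp [genericCoeff, ha, hG.coeff_eq_zero ha]

theorem holdsForGenericForm_initialIdeal_ann_eq [CharZero k] (n e : ℕ) :
    HoldsForGenericForm e (fun G : MvPolynomial (Fin (n + 1)) k =>
      initialIdeal (degRevLex (Fin (n + 1))) (ann G) =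
        initialIdeal (degRevLex (Fin (n + 1))) (ann (hsymm (Fin (n + 1)) k e))) := by
  refine ⟨hankelDetProd n e, fun h0 => ?_, fun G hG hne => ?_⟩
  -- `Φ` is nonzero because its value at the coefficients of `H_e` is nonzero.
  · have h := aeval_hankelDetProd (isHomogeneous_hsymm (σ := Fin (n + 1)) (k := k) e)
    rw [h0, map_zero, eq_comm, Finset.prod_eq_zero_iff] at h
    obtain ⟨i, hi, hdet⟩ := h
    rw [Finset.mem_range] at hi
    exact det_hankel_coeff_hsymm_ne_zero (by omega) hdet
  · rw [aeval_hankelDetProd hG, Finset.prod_ne_zero_iff] at hne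
    rw [initialIdeal_ann_eq_span hG fun i hi => hne i (Finset.mem_range.mpr (by omega)),
      initialIdeal_ann_eq_span (isHomogeneous_hsymm e)
        fun i hi => det_hankel_coeff_hsymm_ne_zero hi]

end HankelHsymm

/-! ### Leading exponents of the basis elements -/

/-- The exponent vector of `x^a x_last^b`. -/
noncomputable def snocExponent {n : ℕ} (p : (Fin n → ℕ) × ℕ) : Fin (n + 1) →₀ ℕ :=
  Finsupp.equivFunOnFinite.symm (Fin.snoc p.1 p.2 : Fin (n + 1) → ℕ)

theorem snocExponent_castSucc {n : ℕ} (p : (Fin n → ℕ) × ℕ) (i : Fin n) :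
    snocExponent p i.castSucc = p.1 i := by
  simp [snocExponent]

theorem snocExponent_last {n : ℕ} (p : (Fin n → ℕ) × ℕ) :
    snocExponent p (Fin.last n) = p.2 := by
  simp [snocExponent]

theorem degree_snocExponent {n : ℕ} (p : (Fin n → ℕ) × ℕ) :
    (snocExponent p).degree = ∑ i, p.1 i + p.2 := by
  simp only [Finsupp.degree_eq_sum, Fin.sum_univ_castSucc, snocExponent_castSucc,
    snocExponent_last]

theorem snocExponent_le_iff {n : ℕ} {p q : (Fin n → ℕ) × ℕ} :
    snocExponent p ≤ snocExponent q ↔ p ≤ q := by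
  rw [Finsupp.le_def, Fin.forall_fin_succ']
  simp only [snocExponent_castSucc, snocExponent_last]
  exact Iff.rfl

theorem snocExponent_surjective {n : ℕ} :
    Function.Surjective (snocExponent : (Fin n → ℕ) × ℕ → Fin (n + 1) →₀ ℕ) := by
  intro u
  refine ⟨(fun i => u i.castSucc, u (Fin.last n)), ?_⟩
  ext i
  refine Fin.lastCases ?_ (fun i => ?_) i
  · rw [snocExponent_last]
  · rw [snocExponent_castSucc]

section BasisElements

variable (k : Type*) [Field k]

theorem degree_X_sub_X_last {n : ℕ} (i : Fin n) :
    (degRevLex (Fin (n + 1))).degree (X i.castSucc - X (Fin.last n) : MvPolynomial _ k) =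
      Finsupp.single i.castSucc 1 := by
  rw [MonomialOrder.degree_sub_of_lt, MonomialOrder.degree_X]
  rw [MonomialOrder.degree_X, MonomialOrder.degree_X]
  refine degRevLex_lt_of_last_lt (by simp) ?_
  simp [(Fin.castSucc_lt_last i).ne]

theorem X_castSucc_sub_X_last_ne_zero {n : ℕ} (i : Fin n) :
    (X i.castSucc - X (Fin.last n) : MvPolynomial _ k) ≠ 0 := by
  rw [sub_ne_zero]
  exact fun h => (Fin.castSucc_lt_last i).ne (X_injective h)

theorem formF_ne_zero (n : ℕ) (a : Fin n → ℕ) : formF k n a ≠ 0 :=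
  Finset.prod_ne_zero_iff.mpr fun i _ => pow_ne_zero _ (X_castSucc_sub_X_last_ne_zero k i)

theorem X_last_pow_mul_formF_ne_zero (n b : ℕ) (a : Fin n → ℕ) :
    X (Fin.last n) ^ b * formF k n a ≠ 0 :=
  mul_ne_zero (pow_ne_zero _ (X_ne_zero _)) (formF_ne_zero k n a)

theorem degree_X_last_pow_mul_formF (n b : ℕ) (a : Fin n → ℕ) :
    (degRevLex (Fin (n + 1))).degree (X (Fin.last n) ^ b * formF k n a) =
      snocExponent (a, b) := by
  rw [MonomialOrder.degree_mul (pow_ne_zero _ (X_ne_zero _)) (formF_ne_zero k n a),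
    MonomialOrder.degree_pow, MonomialOrder.degree_X, formF,
    MonomialOrder.degree_prod fun i _ => pow_ne_zero _ (X_castSucc_sub_X_last_ne_zero k i)]
  simp only [MonomialOrder.degree_pow, degree_X_sub_X_last]
  ext i
  refine Fin.lastCases ?_ (fun i => ?_) i
  · simp [snocExponent_last, (Fin.castSucc_lt_last _).ne]
  · simp [snocExponent_castSucc, Finsupp.single_apply]

theorem isHomogeneous_X_last_pow_mul_formF (n b : ℕ) (a : Fin n → ℕ) :
    (X (Fin.last n) ^ b * formF k n a).IsHomogeneous (b + ∑ i, a i) := by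
  refine (isHomogeneous_X_pow _ _).mul (IsHomogeneous.prod _ _ _ fun i _ => ?_)
  simpa using ((isHomogeneous_X k i.castSucc).sub (isHomogeneous_X k (Fin.last n))).pow (a i)

theorem X_last_pow_mul_formF_mem_pow (n b : ℕ) (a : Fin n → ℕ) :
    X (Fin.last n) ^ b * formF k n a ∈
      (RingHom.ker (eval (1 : Fin (n + 1) → k))) ^ (∑ i, a i) := by
  refine Ideal.mul_mem_left _ _ ?_
  rw [← Finset.prod_pow_eq_pow_sum]
  refine Ideal.prod_mem_prod fun i _ => Ideal.pow_mem_pow ?_ _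
  simp [RingHom.mem_ker]

variable [CharZero k]

/-- The polynomial `φ(x_last^b F_a)`. -/
noncomputable def basisElement (n : ℕ) (p : (Fin n → ℕ) × ℕ) : MvPolynomial (Fin (n + 1)) k :=
  phi k (n + 1) (X (Fin.last n) ^ p.2 * formF k n p.1)

theorem basisElement_ne_zero {n : ℕ} (p : (Fin n → ℕ) × ℕ) : basisElement k n p ≠ 0 := by
  rw [← support_nonempty, basisElement, support_phi, support_nonempty]
  exact X_last_pow_mul_formF_ne_zero k n _ _

/-- In characteristic zero `φ` rescales every coefficient by a nonzero factor, so supports and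
leading exponents do not change. -/
theorem degree_basisElement {n : ℕ} (p : (Fin n → ℕ) × ℕ) :
    (degRevLex (Fin (n + 1))).degree (basisElement k n p) = snocExponent p := by
  rw [← degree_X_last_pow_mul_formF k n p.2 p.1, MonomialOrder.degree, basisElement, support_phi]
  rfl

theorem basisElement_mem_ann {n e : ℕ} {p : (Fin n → ℕ) × ℕ} (hp : e + 1 ≤ 2 * ∑ i, p.1 i + p.2) :
    basisElement k n p ∈ ann (hsymm (Fin (n + 1)) k e) :=
  phi_mem_ann_hsymm (isHomogeneous_X_last_pow_mul_formF k n _ _)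
    (X_last_pow_mul_formF_mem_pow k n _ _) (by omega)

/-- If `P` consists of the minimal pairs `(a, b)` with `e + 1 ≤ 2 |a| + b`, then the polynomials
`φ(x_last^b F_a)` with `(a, b)` in `P` form a minimal Gröbner basis. -/
theorem isMinimalGroebnerBasis_image_basisElement {n e : ℕ} {P : Set ((Fin n → ℕ) × ℕ)}
    (hle : ∀ p ∈ P, e + 1 ≤ 2 * ∑ i, p.1 i + p.2) (hanti : ∀ p ∈ P, ∀ q ∈ P, p ≤ q → p = q)
    (hgen : ∀ p : (Fin n → ℕ) × ℕ, e + 1 ≤ 2 * ∑ i, p.1 i + p.2 → ∃ q ∈ P, q ≤ p) :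
    IsMinimalGroebnerBasis (degRevLex (Fin (n + 1))) (basisElement k n '' P)
      (ann (hsymm (Fin (n + 1)) k e)) where
  finite := by
    -- Dickson's lemma: an antichain of exponent vectors is finite.
    refine Set.Finite.image _ (WellQuasiOrderedLE.finite_of_isAntichain ?_)
    exact fun p hp q hq hne hpq => hne (hanti p hp q hq hpq)
  subset := by
    rintro _ ⟨p, hp, rfl⟩
    exact basisElement_mem_ann k (hle p hp)
  span_leadingTerm := by
    apply le_antisymm
    · refine Ideal.span_mono (Set.image_mono ?_)
      rintro _ ⟨p, hp, rfl⟩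
      exact basisElement_mem_ann k (hle p hp)
    · rw [initialIdeal_ann_eq_span (isHomogeneous_hsymm e)
        fun i hi => det_hankel_coeff_hsymm_ne_zero hi, Ideal.span_le]
      rintro _ ⟨u, hu, rfl⟩
      obtain ⟨p, rfl⟩ := snocExponent_surjective u
      rw [Set.mem_ofPred_eq, snocExponent_last, degree_snocExponent] at hu
      obtain ⟨q, hq, hqp⟩ := hgen p (by omega)
      obtain ⟨v, hv⟩ := exists_add_of_le (snocExponent_le_iff.mpr hqp)
      have hlc : (degRevLex (Fin (n + 1))).leadingCoeff (basisElement k n q) ≠ 0 :=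
        MonomialOrder.leadingCoeff_ne_zero_iff.mpr (basisElement_ne_zero k q)
      have hmul : monomial (snocExponent p) (1 : k) =
          monomial v ((degRevLex (Fin (n + 1))).leadingCoeff (basisElement k n q))⁻¹ *
            (degRevLex (Fin (n + 1))).leadingTerm (basisElement k n q) := by
        rw [MonomialOrder.leadingTerm, monomial_mul, degree_basisElement, inv_mul_cancel₀ hlc,
          hv, add_comm v]
      rw [SetLike.mem_coe]
      simp only [hmul]
      exact Ideal.mul_mem_left _ _ (Ideal.subset_span ⟨_, ⟨q, hq, rfl⟩, rfl⟩)
  ne_zero := by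
    rintro _ ⟨p, -, rfl⟩
    exact basisElement_ne_zero k p
  not_dvd := by
    rintro _ ⟨p, hp, rfl⟩ _ ⟨q, hq, rfl⟩ hne hdvd
    rw [degree_basisElement, degree_basisElement, snocExponent_le_iff] at hdvd
    exact hne (congrArg _ (hanti p hp q hq hdvd))

end BasisElements

/-! ### Minimal exponent pairs for even and odd degree -/

theorem exists_le_sum_eq {n m : ℕ} (a : Fin n → ℕ) (h : m ≤ ∑ i, a i) :
    ∃ b ≤ a, ∑ i, b i = m := by
  obtain ⟨g, hg, hgm⟩ := Finsupp.exists_le_degree_eq (Finsupp.equivFunOnFinite.symm a) m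
    (by simpa [Finsupp.degree_eq_sum] using h)
  exact ⟨g, hg, by rw [← hgm, Finsupp.degree_eq_sum]⟩

theorem eq_of_le_of_sum_le {n : ℕ} {p q : (Fin n → ℕ) × ℕ} (h : p ≤ q)
    (hsum : ∑ i, q.1 i ≤ ∑ i, p.1 i) (hsnd : q.2 ≤ p.2) : p = q := by
  refine Prod.ext ?_ (le_antisymm h.2 hsnd)
  funext i
  exact (Finset.sum_eq_sum_iff_of_le fun i _ => h.1 i).mp
    (le_antisymm (Finset.sum_le_sum fun i _ => h.1 i) hsum) i (Finset.mem_univ i)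

section Main

variable (k : Type*) [Field k]

theorem evenBasis_eq_image (n d : ℕ) : evenBasis k n d = basisElement k n ''
    {p | (∑ i, p.1 i = d + 1 ∧ p.2 = 0) ∨ ∃ i, i + ∑ j, p.1 j = d ∧ p.2 = 2 * i + 1} := by
  ext f
  constructor
  · rintro (⟨a, ha, rfl⟩ | ⟨i, a, -, ha, rfl⟩)
    · exact ⟨(a, 0), Or.inl ⟨ha, rfl⟩, by simp [basisElement]⟩
    · exact ⟨(a, 2 * i + 1), Or.inr ⟨i, ha, rfl⟩, rfl⟩
  · rintro ⟨⟨a, b⟩, ⟨ha, rfl : b = 0⟩ | ⟨i, ha, rfl : b = 2 * i + 1⟩, rfl⟩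
    · exact Or.inl ⟨a, ha, by simp [basisElement]⟩
    · exact Or.inr ⟨i, a, (Nat.le_add_right _ _).trans ha.le, ha, rfl⟩

theorem oddBasis_eq_image (n d : ℕ) : oddBasis k n d = basisElement k n ''
    {p | ∃ i, i + ∑ j, p.1 j = d + 1 ∧ p.2 = 2 * i} := by
  ext f
  constructor
  · rintro ⟨i, a, -, ha, rfl⟩
    exact ⟨(a, 2 * i), ⟨i, ha, rfl⟩, rfl⟩
  · rintro ⟨⟨a, b⟩, ⟨i, ha, rfl : b = 2 * i⟩, rfl⟩
    exact ⟨i, a, (Nat.le_add_right _ _).trans ha.le, ha, rfl⟩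

variable [CharZero k]

theorem isMinimalGroebnerBasis_evenBasis (n d : ℕ) :
    IsMinimalGroebnerBasis (degRevLex (Fin (n + 1))) (evenBasis k n d)
      (ann (hsymm (Fin (n + 1)) k (2 * d))) := by
  rw [evenBasis_eq_image]
  refine isMinimalGroebnerBasis_image_basisElement k ?_ ?_ ?_
  · rintro p (⟨h, h'⟩ | ⟨i, h, h'⟩) <;> omega
  · intro p hp q hq hpq
    have hsum : ∑ i, p.1 i ≤ ∑ i, q.1 i := Finset.sum_le_sum fun i _ => hpq.1 i
    have hsnd := hpq.2
    -- Pairs of different kinds are incomparable: the first kind has the larger `|a|`, the second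
    -- the larger `b`. Within a kind, `p ≤ q` forces equal sums and equal last exponents.
    rcases hp with ⟨h, h'⟩ | ⟨i, h, h'⟩ <;> rcases hq with ⟨g, g'⟩ | ⟨j, g, g'⟩ <;>
      exact eq_of_le_of_sum_le hpq (by omega) (by omega)
  · rintro ⟨a, b⟩ h
    by_cases ha : d + 1 ≤ ∑ i, a i
    · obtain ⟨a', ha', hsum⟩ := exists_le_sum_eq a ha
      exact ⟨(a', 0), Or.inl ⟨hsum, rfl⟩, ha', Nat.zero_le _⟩
    -- With `a` kept, this is the smallest last exponent allowed by `2d + 1 ≤ 2|a| + b`; its oddness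
    -- explains the powers `2i + 1`.
    · exact ⟨(a, 2 * (d - ∑ i, a i) + 1), Or.inr ⟨d - ∑ i, a i, by dsimp only; omega, rfl⟩,
        le_rfl, by dsimp only at h ⊢; omega⟩

theorem isMinimalGroebnerBasis_oddBasis (n d : ℕ) :
    IsMinimalGroebnerBasis (degRevLex (Fin (n + 1))) (oddBasis k n d)
      (ann (hsymm (Fin (n + 1)) k (2 * d + 1))) := by
  rw [oddBasis_eq_image]
  refine isMinimalGroebnerBasis_image_basisElement k ?_ ?_ ?_
  · rintro p ⟨i, h, h'⟩
    omega
  · rintro p ⟨i, h, h'⟩ q ⟨j, g, g'⟩ hpq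
    have hsum : ∑ i, p.1 i ≤ ∑ i, q.1 i := Finset.sum_le_sum fun i _ => hpq.1 i
    have hsnd := hpq.2
    exact eq_of_le_of_sum_le hpq (by omega) (by omega)
  · rintro ⟨a, b⟩ h
    by_cases ha : d + 1 ≤ ∑ i, a i
    · obtain ⟨a', ha', hsum⟩ := exists_le_sum_eq a ha
      exact ⟨(a', 0), ⟨0, by dsimp only; omega, rfl⟩, ha', Nat.zero_le _⟩
    -- Here the bound is `2d + 2 ≤ 2|a| + b`, so the smallest last exponent is even and one family
    -- suffices.
    · exact ⟨(a, 2 * (d + 1 - ∑ i, a i)), ⟨d + 1 - ∑ i, a i, by dsimp only; omega, rfl⟩,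
        le_rfl, by dsimp only at h ⊢; omega⟩

end Main

theorem theorem3p4 {k : Type*} [Field k] [CharZero k] (n e : ℕ) (he : 1 ≤ e) :
    HoldsForGenericForm e (fun G : MvPolynomial (Fin (n + 1)) k =>
      initialIdeal (degRevLex (Fin (n + 1))) (ann G) =
        initialIdeal (degRevLex (Fin (n + 1))) (ann (hsymm (Fin (n + 1)) k e))) ∧
    (∀ d : ℕ, e = 2 * d →
      IsMinimalGroebnerBasis (degRevLex (Fin (n + 1))) (evenBasis k n d)
        (ann (hsymm (Fin (n + 1)) k e))) ∧
    (∀ d : ℕ, e = 2 * d + 1 →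
      IsMinimalGroebnerBasis (degRevLex (Fin (n + 1))) (oddBasis k n d)
        (ann (hsymm (Fin (n + 1)) k e))) := by
  refine ⟨holdsForGenericForm_initialIdeal_ann_eq n e, ?_, ?_⟩
  · rintro d rfl
    exact isMinimalGroebnerBasis_evenBasis k n d
  · rintro d rfl
    exact isMinimalGroebnerBasis_oddBasis k n d
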